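/- Let $A,B,J$ be finite-dimensional complex Hilbert spaces with $|J|=\dim J\ge 1$, let $\mathcal N:\mathcal L(A\otimes J)\to\mathcal L(B)$ be a completely positive trace preserving (cptp) map, the quantum arbitrarily varying channel (QAVC), and let $\ell,L\ge 0$ be integers. For an operator $\zeta$ on $J^\ell=J^{\otimes\ell}$ let $\mathcal N^{\otimes\ell}_\zeta(\rho):=\mathcal N^{\otimes\ell}(\rho\otimes\zeta)$ for $\rho\in\mathcal L(A^\ell)$. A quantum code of block length $\ell$ and size $L$ is a pair $\mathcal Q=(\mathcal E,\mathcal D)$ of cptp maps $\mathcal E:\mathcal L(\mathbb C^L)\to\mathcal L(A^\ell)$ and $\mathcal D:\mathcal L(B^\ell)\to\mathcal L(\mathbb C^L)$; its infidelity with respect to a state $\zeta$ on $J^\ell$ is \[ \widehat F(\mathcal Q,\zeta):=1-\operatorname{tr}\Bigl(\bigl((\mathrm{id}\otimes\mathcal D\circ\mathcal N^{\otimes\ell}_\zeta\circ\mathcal E)\Phi_L\bigr)\,\Phi_L\Bigr),\qquad \Phi_L=\frac1L\sum_{i,j=1}^L|ii\rangle\langle jj| \quad(\Phi_0:=0). \]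 For $\pi\in S_\ell$ let $U^\pi$ be the unitary on an $\ell$-fold tensor power with $U^\pi|\alpha_1\rangle\cdots|\alpha_\ell\rangle=|\alpha_{\pi^{-1}(1)}\rangle\cdots|\alpha_{\pi^{-1}(\ell)}\rangle$, and let $\mathcal U_\pi(X)=U^\pi XU^{\pi\dagger}$. Let $\mathcal Q=(\mathcal E,\mathcal D)$ be a quantum code of block length $\ell$ and size $L$ and let $\epsilon\in\mathbb R$ be such that $\widehat F(\mathcal Q,\sigma^{\otimes\ell})\le\epsilon$ for all states $\sigma$ on $J$. Then the random quantum code $(\mathcal Q_\pi)_{\pi\in S_\ell}$, $\mathcal Q_\pi:=(\mathcal U_\pi\circ\mathcal E,\ \mathcal D\circ\mathcal U_{\pi^{-1}})$, with $\pi$ uniformly distributed on $S_\ell$, satisfies, for every state $\zeta$ on $J^\ell$, \[ \mathbb E_\pi\,\widehat F(\mathcal Q_\pi,\zeta)=\frac1{\ell!}\sum_{\pi\in S_\ell}\widehat F(\mathcal Q_\pi,\zeta)\le\epsilon\,(\ell+1)^{|J|^2}. \] -/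

import Mathlib

open scoped BigOperators Kronecker ComplexOrder

namespace QAVC

noncomputable section

/-! A finite-dimensional Hilbert space is `ℂ^m` for a finite index type `m`, so that the algebra of
operators on it is `Matrix m m ℂ`; tensor products are indexed by product types, and the `ℓ`-fold
tensor power is indexed by `Fin ℓ → m`. -/

/-- A state: a positive semidefinite operator of trace one. -/
def IsState {m : Type*} [Fintype m] (ρ : Matrix m m ℂ) : Prop :=
  ρ.PosSemidef ∧ ρ.trace = 1

/-- The map `id_r ⊗ Φ`, which applies `Φ` to each block of an operator on `ℂ^r ⊗ ℂ^m`. -/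
def ampliation (r : Type*) {m n : Type*} (Φ : Matrix m m ℂ →ₗ[ℂ] Matrix n n ℂ) :
    Matrix (r × m) (r × m) ℂ →ₗ[ℂ] Matrix (r × n) (r × n) ℂ where
  toFun X := Matrix.of fun p q => Φ (Matrix.of fun x y => X (p.1, x) (q.1, y)) p.2 q.2
  map_add' X Y := by
    ext p q
    exact congrFun (congrFun (Φ.map_add (Matrix.of fun x y => X (p.1, x) (q.1, y))
      (Matrix.of fun x y => Y (p.1, x) (q.1, y))) p.2) q.2
  map_smul' c X := by
    ext p q
    exact congrFun (congrFun (Φ.map_smul c (Matrix.of fun x y => X (p.1, x) (q.1, y))) p.2) q.2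

/-- Complete positivity: `id_{ℂ^k} ⊗ Φ` is positive for every `k`. -/
def IsCompletelyPositive {m n : Type*} (Φ : Matrix m m ℂ →ₗ[ℂ] Matrix n n ℂ) : Prop :=
  ∀ (k : ℕ) (X : Matrix (Fin k × m) (Fin k × m) ℂ),
    X.PosSemidef → (ampliation (Fin k) Φ X).PosSemidef

/-- Trace preservation. -/
def IsTracePreserving {m n : Type*} [Fintype m] [Fintype n]
    (Φ : Matrix m m ℂ →ₗ[ℂ] Matrix n n ℂ) : Prop :=
  ∀ X : Matrix m m ℂ, (Φ X).trace = X.trace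

/-- A quantum channel: a completely positive and trace preserving (cptp) linear map. -/
structure Channel (m n : Type*) [Fintype m] [Fintype n] where
  map : Matrix m m ℂ →ₗ[ℂ] Matrix n n ℂ
  completelyPositive : IsCompletelyPositive map
  tracePreserving : IsTracePreserving map

/-- The composition `Ψ ∘ Φ` of two channels. -/
def Channel.comp {m n p : Type*} [Fintype m] [Fintype n] [Fintype p]
    (Ψ : Channel n p) (Φ : Channel m n) : Channel m p where
  map := Ψ.map ∘ₗ Φ.map
  completelyPositive := fun k X hX =>
    Ψ.completelyPositive k _ (Φ.completelyPositive k X hX)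
  tracePreserving := fun X =>
    (Ψ.tracePreserving (Φ.map X)).trans (Φ.tracePreserving X)

/-- The tensor power `Φ^{⊗ℓ}` of a linear map, given by its values on the matrix units
`⨂ i, |x i⟩⟨x' i|`, each of which is sent to `⨂ i, Φ(|x i⟩⟨x' i|)`. -/
def tensorPowerMap {m n : Type*} [Fintype m] [DecidableEq m]
    (Φ : Matrix m m ℂ →ₗ[ℂ] Matrix n n ℂ) (ℓ : ℕ) :
    Matrix (Fin ℓ → m) (Fin ℓ → m) ℂ →ₗ[ℂ] Matrix (Fin ℓ → n) (Fin ℓ → n) ℂ where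
  toFun X := Matrix.of fun y y' =>
    ∑ x, ∑ x', X x x' * ∏ i, Φ (Matrix.single (x i) (x' i) 1) (y i) (y' i)
  map_add' X Y := by
    ext y y'
    simp [add_mul, Finset.sum_add_distrib]
  map_smul' c X := by
    ext y y'
    simp [mul_assoc, Finset.mul_sum]

/-- The tensor power `σ^{⊗ℓ}` of an operator. -/
def tensorPower {m : Type*} (σ : Matrix m m ℂ) (ℓ : ℕ) :
    Matrix (Fin ℓ → m) (Fin ℓ → m) ℂ :=
  Matrix.of fun x y => ∏ i, σ (x i) (y i)

/-- The map `N^{⊗ℓ}`, seen as a map on operators on `A^ℓ ⊗ J^ℓ`, for `N` a map on operators on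
`A ⊗ J`. -/
def blockMap {A J B : Type*} [Fintype A] [DecidableEq A] [Fintype J] [DecidableEq J]
    (N : Matrix (A × J) (A × J) ℂ →ₗ[ℂ] Matrix B B ℂ) (ℓ : ℕ) :
    Matrix ((Fin ℓ → A) × (Fin ℓ → J)) ((Fin ℓ → A) × (Fin ℓ → J)) ℂ →ₗ[ℂ]
      Matrix (Fin ℓ → B) (Fin ℓ → B) ℂ :=
  tensorPowerMap N ℓ ∘ₗ
    (Matrix.reindexLinearEquiv ℂ ℂ (Equiv.arrowProdEquivProdArrow (Fin ℓ) (fun _ => A) (fun _ => J)).symm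
      (Equiv.arrowProdEquivProdArrow (Fin ℓ) (fun _ => A) (fun _ => J)).symm).toLinearMap

/-- The map `M_σ : ρ ↦ M (ρ ⊗ σ)`, where the jammer's input is fixed to `σ`. -/
def fixJammer {A J B : Type*} (M : Matrix (A × J) (A × J) ℂ →ₗ[ℂ] Matrix B B ℂ)
    (σ : Matrix J J ℂ) : Matrix A A ℂ →ₗ[ℂ] Matrix B B ℂ where
  toFun ρ := M (ρ ⊗ₖ σ)
  map_add' ρ ρ' := by rw [Matrix.add_kronecker, map_add]
  map_smul' c ρ := by rw [Matrix.smul_kronecker, map_smul, RingHom.id_apply]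

/-- The maximally entangled state `Φ_L = (1/L) ∑_{i,j} |ii⟩⟨jj|`. -/
def maxEntangled (L : ℕ) : Matrix (Fin L × Fin L) (Fin L × Fin L) ℂ :=
  Matrix.of fun p q => if p.1 = p.2 ∧ q.1 = q.2 then (1 : ℂ) / L else 0

/-- A (deterministic) quantum code of block length `ℓ` and size `L`: a pair of channels. -/
structure QuantumCode (A B : Type*) [Fintype A] [Fintype B] (ℓ L : ℕ) where
  enc : Channel (Fin L) (Fin ℓ → A)
  dec : Channel (Fin ℓ → B) (Fin L)

/-- The infidelity `1 - tr ((id ⊗ D ∘ (N^{⊗ℓ})_ζ ∘ E) Φ_L) Φ_L` of a code `(E, D)` with respect to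
an operator `ζ` on `J^ℓ`. (For a state `ζ` this trace is a real number.) -/
def infidelity {A J B : Type*} [Fintype A] [DecidableEq A] [Fintype J] [DecidableEq J] [Fintype B]
    (N : Channel (A × J) B) {ℓ L : ℕ} (Q : QuantumCode A B ℓ L)
    (ζ : Matrix (Fin ℓ → J) (Fin ℓ → J) ℂ) : ℝ :=
  1 - (ampliation (Fin L) (Q.dec.map ∘ₗ fixJammer (blockMap N.map ℓ) ζ ∘ₗ Q.enc.map)
        (maxEntangled L) * maxEntangled L).trace.re

/-- The permutation operator `U^π |x 1⟩ ⋯ |x ℓ⟩ = |x (π⁻¹ 1)⟩ ⋯ |x (π⁻¹ ℓ)⟩` on a tensor power. -/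
def permOp (m : Type*) [DecidableEq m] {ℓ : ℕ} (π : Equiv.Perm (Fin ℓ)) :
    Matrix (Fin ℓ → m) (Fin ℓ → m) ℂ :=
  Matrix.of fun y x => if y = x ∘ ⇑π⁻¹ then 1 else 0

theorem permOp_unitary (m : Type*) [Fintype m] [DecidableEq m] {ℓ : ℕ}
    (π : Equiv.Perm (Fin ℓ)) : (permOp m π).conjTranspose * permOp m π = 1 := by
  ext x y
  have h : (x ∘ ⇑π⁻¹ = y ∘ ⇑π⁻¹) ↔ x = y :=
    (Equiv.surjective π⁻¹).injective_comp_right.eq_iff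
  simp only [permOp, Matrix.mul_apply, Matrix.conjTranspose_apply, Matrix.of_apply,
    Matrix.one_apply, apply_ite star, star_one, star_zero, ite_mul, one_mul, zero_mul,
    Finset.sum_ite_eq', Finset.mem_univ, if_true, h]

/-- The conjugation `X ↦ U X U†`. -/
def conjMap {m : Type*} [Fintype m] (U : Matrix m m ℂ) : Matrix m m ℂ →ₗ[ℂ] Matrix m m ℂ where
  toFun X := U * X * U.conjTranspose
  map_add' X Y := by rw [mul_add, add_mul]
  map_smul' c X := by simp

theorem ampliation_conjMap {m : Type*} [Fintype m] (U : Matrix m m ℂ) (k : ℕ)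
    (X : Matrix (Fin k × m) (Fin k × m) ℂ) :
    ampliation (Fin k) (conjMap U) X =
      ((1 : Matrix (Fin k) (Fin k) ℂ) ⊗ₖ U) * X *
        ((1 : Matrix (Fin k) (Fin k) ℂ) ⊗ₖ U).conjTranspose := by
  ext p q
  simp [ampliation, conjMap, Matrix.mul_apply, Fintype.sum_prod_type, Matrix.one_apply,
    apply_ite star, ite_mul, mul_ite, Finset.sum_ite_irrel]

/-- The channel `𝒰_π : X ↦ U^π X U^{π†}`. -/
def permChannel (m : Type*) [Fintype m] [DecidableEq m] {ℓ : ℕ} (π : Equiv.Perm (Fin ℓ)) :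
    Channel (Fin ℓ → m) (Fin ℓ → m) where
  map := conjMap (permOp m π)
  completelyPositive := fun k X hX => by
    rw [ampliation_conjMap]
    exact hX.mul_mul_conjTranspose_same _
  tracePreserving := fun X => by
    change (permOp m π * X * (permOp m π).conjTranspose).trace = X.trace
    rw [Matrix.trace_mul_comm, ← mul_assoc, permOp_unitary, one_mul]

/-- The permuted code `Q_π = (𝒰_π ∘ E, D ∘ 𝒰_{π⁻¹})`. -/
def QuantumCode.permute {A B : Type*} [Fintype A] [DecidableEq A] [Fintype B] [DecidableEq B]
    {ℓ L : ℕ} (Q : QuantumCode A B ℓ L) (π : Equiv.Perm (Fin ℓ)) : QuantumCode A B ℓ L where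
  enc := (permChannel A π).comp Q.enc
  dec := Q.dec.comp (permChannel B π⁻¹)

/-- The error of a random quantum code `(Q_λ)` with `λ` uniformly distributed on a finite set: the
expectation over `λ` of the infidelity. -/
def randomInfidelity {A J B : Type*} [Fintype A] [DecidableEq A] [Fintype J] [DecidableEq J]
    [Fintype B] (N : Channel (A × J) B) {ℓ L : ℕ} {Λ : Type*} [Fintype Λ]
    (Q : Λ → QuantumCode A B ℓ L) (ζ : Matrix (Fin ℓ → J) (Fin ℓ → J) ℂ) : ℝ :=
  (∑ lam, infidelity N (Q lam) ζ) / Fintype.card Λ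

end

end QAVC

/-! Averaging the code over permutations amounts to averaging the jammer's state, so one may assume
that `ζ` is permutation invariant and write `ζ = R† R` with `R` permutation invariant. The
infidelity is a positive functional `F` of `ζ`, hence `F (R† R) = ‖T R‖²` for a linear map `T` into
a (semi-)inner product space (GNS). The hypothesis on product states says
`‖T (w^{⊗ℓ})‖² ≤ ε ‖w‖^{2ℓ}` for every operator `w` on `J`. The left-hand side is the squared norm
of a polynomial in the entries of `w`, whose coefficients are the images under `T` of the
indicators of the type classes of words over `J × J`. Integrating against a complex Gaussian, for
which distinct monomials are orthogonal, bounds a weighted sum of their squared norms. Since `R` is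
constant on type classes, the Cauchy–Schwarz inequality bounds `‖T R‖²` by `ε ‖R‖²` times the
number of types, which is at most `(ℓ + 1)^{|J|²}`. -/

namespace QAVC

section Gaussian

open MeasureTheory
open scoped ComplexConjugate Nat

/-- The standard complex Gaussian measure on `ℂ`, scaled so that `‖z‖ ^ 2` has mean one. Its
moments are what extracts the coefficients of a polynomial from bounds on its values. -/
noncomputable def complexGaussian : Measure ℂ :=
  volume.withDensity fun z => ENNReal.ofReal (Real.pi⁻¹ * Real.exp (-‖z‖ ^ 2))

theorem integral_norm_pow_mul_exp_neg_norm_sq (k : ℕ) :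
    ∫ z : ℂ, ‖z‖ ^ k * Real.exp (-‖z‖ ^ 2) = Real.pi * Real.Gamma ((k + 2) / 2) := by
  have hk : (-2 : ℝ) < k := by linarith [k.cast_nonneg (α := ℝ)]
  have h := Complex.integral_rpow_mul_exp_neg_rpow one_le_two hk
  simp_rw [Real.rpow_natCast, Real.rpow_two] at h
  rw [h, mul_div_cancel_left₀ _ two_ne_zero]

theorem integrable_norm_pow_mul_exp_neg_norm_sq (k : ℕ) :
    Integrable fun z : ℂ => ‖z‖ ^ k * Real.exp (-‖z‖ ^ 2) :=
  .of_integral_ne_zero <| by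
    rw [integral_norm_pow_mul_exp_neg_norm_sq]
    positivity

instance : IsFiniteMeasure complexGaussian :=
  isFiniteMeasure_withDensity_ofReal <| Integrable.hasFiniteIntegral <| by
    simpa using (integrable_norm_pow_mul_exp_neg_norm_sq 0).const_mul Real.pi⁻¹

theorem integral_complexGaussian {E : Type*} [NormedAddCommGroup E] [NormedSpace ℝ E] (f : ℂ → E) :
    ∫ z, f z ∂complexGaussian = ∫ z, (Real.pi⁻¹ * Real.exp (-‖z‖ ^ 2)) • f z := by
  rw [complexGaussian, integral_withDensity_eq_integral_toReal_smul (by fun_prop) (by simp)]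
  refine integral_congr_ae (.of_forall fun z => ?_)
  simp only [ENNReal.toReal_ofReal (show 0 ≤ Real.pi⁻¹ * Real.exp (-‖z‖ ^ 2) by positivity)]

theorem integrable_norm_pow_complexGaussian (k : ℕ) :
    Integrable (fun z => ‖z‖ ^ k) complexGaussian := by
  rw [complexGaussian, integrable_withDensity_iff (by fun_prop) (by simp)]
  convert! (integrable_norm_pow_mul_exp_neg_norm_sq k).const_mul Real.pi⁻¹ using 2 with z
  rw [ENNReal.toReal_ofReal (by positivity)]
  ring

theorem integral_norm_sq_pow_complexGaussian (k : ℕ) :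
    ∫ z, (‖z‖ ^ 2) ^ k ∂complexGaussian = k ! := by
  simp only [integral_complexGaussian, smul_eq_mul, mul_assoc, integral_const_mul]
  have h := integral_norm_pow_mul_exp_neg_norm_sq (2 * k)
  have hk : ((2 * k : ℕ) + 2 : ℝ) / 2 = k + 1 := by push_cast; ring
  rw [hk, Real.Gamma_nat_eq_factorial] at h
  simp only [← pow_mul, mul_comm (Real.exp _), h]
  field_simp

theorem integral_complexGaussian_comp_circle_mul {E : Type*} [NormedAddCommGroup E]
    [NormedSpace ℝ E] (f : ℂ → E) (u : Circle) :
    ∫ z, f (u * z) ∂complexGaussian = ∫ z, f z ∂complexGaussian := by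
  rw [integral_complexGaussian, integral_complexGaussian]
  have h := (rotation u).measurePreserving.integral_comp
    (rotation u).toHomeomorph.measurableEmbedding
    fun z => (Real.pi⁻¹ * Real.exp (-‖z‖ ^ 2)) • f z
  simp only [LinearIsometryEquiv.norm_map] at h
  exact h

theorem integrable_conj_pow_mul_pow_complexGaussian (a b : ℕ) :
    Integrable (fun z => conj z ^ a * z ^ b) complexGaussian :=
  (integrable_norm_pow_complexGaussian (a + b)).mono' (by fun_prop) <|
    .of_forall fun z => by simp [pow_add]

theorem integral_conj_pow_mul_pow_complexGaussian (a b : ℕ) :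
    ∫ z, conj z ^ a * z ^ b ∂complexGaussian = if a = b then (a ! : ℂ) else 0 := by
  split_ifs with hab
  · simp_rw [← hab, ← mul_pow, Complex.conj_mul', ← Complex.ofReal_pow, integral_complex_ofReal,
      integral_norm_sq_pow_complexGaussian, Complex.ofReal_natCast]
  -- Rotating by the angle `π / (b - a)` changes the sign of `conj z ^ a * z ^ b`.
  · have hba : (b : ℂ) - a ≠ 0 := sub_ne_zero.2 <| mod_cast Ne.symm hab
    set u : Circle := Circle.exp (Real.pi / (b - a)) with hu
    have hsign : conj (u : ℂ) ^ a * (u : ℂ) ^ b = -1 := by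
      rw [hu, Circle.coe_exp, ← Complex.exp_conj, ← Complex.exp_nat_mul, ← Complex.exp_nat_mul,
        ← Complex.exp_add, ← Complex.exp_pi_mul_I]
      congr 1
      simp only [Complex.ofReal_div, Complex.ofReal_sub, Complex.ofReal_natCast, map_mul, map_div₀,
        map_sub, map_natCast, Complex.conj_ofReal, Complex.conj_I]
      field_simp
      ring
    have hrot (z : ℂ) : conj (u * z) ^ a * (u * z) ^ b = -(conj z ^ a * z ^ b) := by
      rw [map_mul, mul_pow, mul_pow, mul_mul_mul_comm, hsign, neg_one_mul]
    have h := integral_complexGaussian_comp_circle_mul (fun z => conj z ^ a * z ^ b) u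
    simp_rw [hrot, integral_neg] at h
    exact self_eq_neg.1 h.symm

variable {n : Type*} [Fintype n]

theorem integrable_conj_monomial_mul_monomial_complexGaussian (s t : n → ℕ) :
    Integrable (fun w : n → ℂ => conj (∏ j, w j ^ s j) * ∏ j, w j ^ t j)
      (Measure.pi fun _ => complexGaussian) := by
  simp_rw [map_prod, map_pow, ← Finset.prod_mul_distrib]
  exact Integrable.fintype_prod fun j => integrable_conj_pow_mul_pow_complexGaussian (s j) (t j)

theorem integral_conj_monomial_mul_monomial_complexGaussian (s t : n → ℕ) :
    ∫ w : n → ℂ, conj (∏ j, w j ^ s j) * ∏ j, w j ^ t j ∂.pi (fun _ => complexGaussian) =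
      if s = t then (∏ j, (s j)! : ℂ) else 0 := by
  simp_rw [map_prod, map_pow, ← Finset.prod_mul_distrib]
  rw [integral_fintype_prod_eq_prod (fun j z => conj z ^ s j * z ^ t j)]
  simp_rw [integral_conj_pow_mul_pow_complexGaussian, Finset.prod_ite_zero, Finset.mem_univ,
    true_imp_iff, ← funext_iff]

theorem integral_norm_sq_sum_monomial_smul_complexGaussian {E : Type*} [SeminormedAddCommGroup E]
    [InnerProductSpace ℂ E] (s : Finset (n → ℕ)) (v : (n → ℕ) → E) :
    ∫ w : n → ℂ, ‖∑ t ∈ s, (∏ j, w j ^ t j) • v t‖ ^ 2 ∂.pi (fun _ => complexGaussian) =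
      ∑ t ∈ s, (∏ j, (t j)!) * ‖v t‖ ^ 2 := by
  classical
  have hexpand (w : n → ℂ) : ((‖∑ t ∈ s, (∏ j, w j ^ t j) • v t‖ ^ 2 : ℝ) : ℂ) =
      ∑ t ∈ s, ∑ t' ∈ s, (conj (∏ j, w j ^ t j) * ∏ j, w j ^ t' j) * inner ℂ (v t) (v t') := by
    rw [Complex.ofReal_pow]
    refine (inner_self_eq_norm_sq_to_K (𝕜 := ℂ) _).symm.trans ?_
    simp_rw [sum_inner, inner_sum, inner_smul_left, inner_smul_right, mul_assoc]
  have hint (t t' : n → ℕ) := (integrable_conj_monomial_mul_monomial_complexGaussian t t').mul_const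
    (inner ℂ (v t) (v t'))
  refine Complex.ofReal_injective ?_
  rw [← integral_complex_ofReal]
  simp_rw [hexpand]
  rw [integral_finsetSum _ fun t _ => integrable_finsetSum _ fun t' _ => hint t t']
  push_cast
  refine Finset.sum_congr rfl fun t ht => ?_
  rw [integral_finsetSum _ fun t' _ => hint t t']
  simp_rw [integral_mul_const, integral_conj_monomial_mul_monomial_complexGaussian, ite_mul,
    zero_mul, Finset.sum_ite_eq, if_pos ht, inner_self_eq_norm_sq_to_K (𝕜 := ℂ)]
  rfl

theorem integrable_prod_norm_sq_pow_complexGaussian (t : n → ℕ) :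
    Integrable (fun w : n → ℂ => ∏ j, (‖w j‖ ^ 2) ^ t j) (.pi fun _ => complexGaussian) := by
  simp_rw [← pow_mul]
  exact Integrable.fintype_prod fun j => integrable_norm_pow_complexGaussian (2 * t j)

theorem integrable_sum_norm_sq_pow_complexGaussian (ℓ : ℕ) :
    Integrable (fun w : n → ℂ => (∑ j, ‖w j‖ ^ 2) ^ ℓ) (.pi fun _ => complexGaussian) := by
  classical
  simp_rw [Finset.sum_pow_eq_sum_piAntidiag]
  exact integrable_finsetSum _ fun t _ =>
    (integrable_prod_norm_sq_pow_complexGaussian t).const_mul _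

theorem integral_sum_norm_sq_pow_complexGaussian [DecidableEq n] (ℓ : ℕ) :
    ∫ w : n → ℂ, (∑ j, ‖w j‖ ^ 2) ^ ℓ ∂.pi (fun _ => complexGaussian) =
      (Finset.univ.piAntidiag ℓ : Finset (n → ℕ)).card * ℓ ! := by
  simp_rw [Finset.sum_pow_eq_sum_piAntidiag]
  rw [integral_finsetSum _ fun t _ => (integrable_prod_norm_sq_pow_complexGaussian t).const_mul _,
    Finset.sum_congr rfl fun t ht => ?_, Finset.sum_const, nsmul_eq_mul]
  rw [integral_const_mul, integral_fintype_prod_eq_prod fun j z => (‖z‖ ^ 2) ^ t j]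
  simp_rw [integral_norm_sq_pow_complexGaussian]
  rw [← (Finset.mem_piAntidiag.1 ht).1, ← Nat.multinomial_spec]
  push_cast
  ring

end Gaussian

section Words

open scoped Nat

variable {ι n : Type*} [Fintype ι] [DecidableEq n]

/-- The type of a word `x`, in the sense of the method of types: the number of occurrences of each
letter. Words of equal type are the ones that differ by a permutation of the positions. -/
def wordType (x : ι → n) (j : n) : ℕ :=
  Fintype.card {i // x i = j}

theorem wordType_comp_perm (x : ι → n) (π : Equiv.Perm ι) : wordType (x ∘ π) = wordType x :=
  funext fun _ => Fintype.card_congr <| π.subtypeEquiv fun _ => Iff.rfl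

theorem exists_comp_perm_eq_of_wordType_eq {x y : ι → n} (h : wordType x = wordType y) :
    ∃ π : Equiv.Perm ι, x ∘ π = y := by
  let e (j : n) : {i // y i = j} ≃ {i // x i = j} := Fintype.equivOfCardEq (congrFun h j).symm
  refine ⟨(Equiv.sigmaFiberEquiv y).symm.trans
    ((Equiv.sigmaCongrRight e).trans (Equiv.sigmaFiberEquiv x)), funext fun i => ?_⟩
  exact (e (y i) ⟨i, rfl⟩).2

theorem mem_orbit_domMulAct_iff_wordType_eq {x y : ι → n} :
    y ∈ MulAction.orbit (Equiv.Perm ι)ᵈᵐᵃ x ↔ wordType y = wordType x := by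
  constructor
  · rintro ⟨π, rfl⟩
    exact wordType_comp_perm x (DomMulAct.mk.symm π)
  · intro h
    obtain ⟨π, rfl⟩ := exists_comp_perm_eq_of_wordType_eq h.symm
    exact ⟨DomMulAct.mk π, rfl⟩

theorem factorsThrough_wordType {α : Type*} {f : (ι → n) → α}
    (hf : ∀ (π : Equiv.Perm ι) (x : ι → n), f (x ∘ π) = f x) : f.FactorsThrough wordType := by
  intro x y h
  obtain ⟨π, rfl⟩ := exists_comp_perm_eq_of_wordType_eq h
  exact (hf π x).symm

variable [Fintype n]

theorem prod_comp_eq_prod_pow_wordType {M : Type*} [CommMonoid M] (x : ι → n) (f : n → M) :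
    ∏ i, f (x i) = ∏ j, f j ^ wordType x j := by
  simp_rw [← Finset.prod_fiberwise' Finset.univ x f, Finset.prod_const, wordType,
    Fintype.card_subtype]

theorem card_wordType_eq_mul_prod_factorial [DecidableEq ι] (x : ι → n) :
    Finset.card {y : ι → n | wordType y = wordType x} * ∏ j, (wordType x j)! =
      (Fintype.card ι)! := by
  have horbit : Nat.card (MulAction.orbit (Equiv.Perm ι)ᵈᵐᵃ x) =
      Finset.card {y : ι → n | wordType y = wordType x} := by
    rw [← Fintype.card_subtype, ← Nat.card_eq_fintype_card]
    exact Nat.card_congr (Equiv.subtypeEquivRight fun _ => mem_orbit_domMulAct_iff_wordType_eq)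
  have hstab : Nat.card (MulAction.stabilizer (Equiv.Perm ι)ᵈᵐᵃ x) = ∏ j, (wordType x j)! := by
    rw [← Nat.card_congr (DomMulAct.mk.subtypeEquiv fun _ => DomMulAct.mem_stabilizer_iff.symm),
      Nat.card_eq_fintype_card]
    exact DomMulAct.stabilizer_card x
  rw [← horbit, ← hstab, ← Nat.card_prod,
    Nat.card_congr (MulAction.orbitProdStabilizerEquivGroup _ x), ← Nat.card_congr DomMulAct.mk,
    Nat.card_eq_fintype_card, Fintype.card_perm]

theorem card_piAntidiag_univ_le (ℓ : ℕ) :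
    (Finset.univ.piAntidiag ℓ : Finset (n → ℕ)).card ≤ (ℓ + 1) ^ Fintype.card n := by
  have hsub : Finset.univ.piAntidiag ℓ ⊆ Fintype.piFinset fun _ : n => Finset.range (ℓ + 1) := by
    intro t ht
    refine Fintype.mem_piFinset.2 fun j => Finset.mem_range_succ_iff.2 ?_
    rw [← (Finset.mem_piAntidiag.1 ht).1]
    exact Finset.single_le_sum (fun _ _ => Nat.zero_le _) (Finset.mem_univ j)
  simpa using Finset.card_le_card hsub

end Words

section SymmetricTensors

open MeasureTheory
open scoped Nat

variable {E : Type*} [SeminormedAddCommGroup E] [InnerProductSpace ℂ E]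

theorem norm_sum_smul_sq_le {ι : Type*} (s : Finset ι) {c : ι → ℝ} (hc : ∀ i ∈ s, 0 < c i)
    (r : ι → ℂ) (v : ι → E) :
    ‖∑ i ∈ s, r i • v i‖ ^ 2 ≤ (∑ i ∈ s, ‖r i‖ ^ 2 / c i) * ∑ i ∈ s, c i * ‖v i‖ ^ 2 := by
  calc ‖∑ i ∈ s, r i • v i‖ ^ 2 ≤ (∑ i ∈ s, ‖r i‖ * ‖v i‖) ^ 2 := by
        gcongr
        exact (norm_sum_le _ _).trans_eq (Finset.sum_congr rfl fun i _ => norm_smul _ _)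
    _ ≤ (∑ i ∈ s, ‖r i‖ ^ 2 / c i) * ∑ i ∈ s, c i * ‖v i‖ ^ 2 :=
      Finset.sum_sq_le_sum_mul_sum_of_sq_le_mul s
        (fun i hi => div_nonneg (sq_nonneg _) (hc i hi).le)
        (fun i hi => mul_nonneg (hc i hi).le (sq_nonneg _))
        fun i hi => le_of_eq <| by have := (hc i hi).ne'; field_simp

variable {n : Type*} [Fintype n]

theorem sum_prod_factorial_mul_norm_sq_le [DecidableEq n] {ℓ : ℕ} {ε : ℝ} {s : Finset (n → ℕ)}
    {v : (n → ℕ) → E}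
    (hv : ∀ w : n → ℂ, ‖∑ t ∈ s, (∏ j, w j ^ t j) • v t‖ ^ 2 ≤ ε * (∑ j, ‖w j‖ ^ 2) ^ ℓ) :
    ∑ t ∈ s, (∏ j, (t j)! : ℕ) * ‖v t‖ ^ 2 ≤
      ε * ((Finset.univ.piAntidiag ℓ : Finset (n → ℕ)).card * ℓ !) := by
  rw [← integral_norm_sq_sum_monomial_smul_complexGaussian,
    ← integral_sum_norm_sq_pow_complexGaussian, ← integral_const_mul]
  exact integral_mono_of_nonneg (.of_forall fun _ => sq_nonneg _)
    ((integrable_sum_norm_sq_pow_complexGaussian ℓ).const_mul ε) (.of_forall hv)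

theorem map_comp_wordType [DecidableEq n] {M ι : Type*} [AddCommMonoid M] [Module ℂ M] [Fintype ι]
    [DecidableEq ι] (T : ((ι → n) → ℂ) →ₗ[ℂ] M) (g : (n → ℕ) → ℂ) :
    T (g ∘ wordType) = ∑ t ∈ Finset.univ.image (wordType : (ι → n) → n → ℕ),
      g t • ∑ x with wordType x = t, T (Pi.single x 1) := by
  rw [LinearMap.pi_apply_eq_sum_univ, ← Finset.sum_fiberwise_of_maps_to fun x hx =>
    Finset.mem_image_of_mem wordType hx]
  refine Finset.sum_congr rfl fun t _ => ?_
  rw [Finset.smul_sum]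
  refine Finset.sum_congr rfl fun x hx => ?_
  rw [Function.comp_apply, (Finset.mem_filter.1 hx).2]
  congr 2
  ext
  simp [Pi.single_apply, eq_comm]

theorem sum_norm_sq_div_prod_factorial [DecidableEq n] {ι : Type*} [Fintype ι] [DecidableEq ι]
    (r : (n → ℕ) → ℂ) :
    ∑ t ∈ Finset.univ.image (wordType : (ι → n) → n → ℕ), ‖r t‖ ^ 2 / (∏ j, (t j)! : ℕ) =
      (∑ x : ι → n, ‖r (wordType x)‖ ^ 2) / (Fintype.card ι)! := by
  rw [Finset.sum_comp (fun t => ‖r t‖ ^ 2) wordType, Finset.sum_div]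
  refine Finset.sum_congr rfl fun t ht => ?_
  obtain ⟨x, -, rfl⟩ := Finset.mem_image.1 ht
  rw [← card_wordType_eq_mul_prod_factorial x, nsmul_eq_mul, Nat.cast_mul,
    mul_div_mul_left]
  exact mod_cast (Finset.card_pos.2 ⟨x, by simp⟩).ne'

theorem norm_sq_le_of_symmetric {ℓ : ℕ} (T : ((Fin ℓ → n) → ℂ) →ₗ[ℂ] E) {ε : ℝ} (hε : 0 ≤ ε)
    (hT : ∀ w : n → ℂ, ‖T fun x => ∏ i, w (x i)‖ ^ 2 ≤ ε * (∑ j, ‖w j‖ ^ 2) ^ ℓ)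
    {R : (Fin ℓ → n) → ℂ} (hR : ∀ (π : Equiv.Perm (Fin ℓ)) x, R (x ∘ π) = R x) :
    ‖T R‖ ^ 2 ≤ ε * (ℓ + 1) ^ Fintype.card n * ∑ x, ‖R x‖ ^ 2 := by
  classical
  obtain ⟨r, rfl⟩ := (Function.factorsThrough_iff R).1 (factorsThrough_wordType hR)
  let types := Finset.univ.image (wordType : (Fin ℓ → n) → n → ℕ)
  let v (t : n → ℕ) := ∑ x : Fin ℓ → n with wordType x = t, T (Pi.single x 1)
  have hpoly (w : n → ℂ) : T (fun x => ∏ i, w (x i)) = ∑ t ∈ types, (∏ j, w j ^ t j) • v t := by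
    rw [← map_comp_wordType T fun t => ∏ j, w j ^ t j]
    exact congrArg T (funext fun x => prod_comp_eq_prod_pow_wordType x w)
  have hcoeff : ∑ t ∈ types, (∏ j, (t j)! : ℕ) * ‖v t‖ ^ 2 ≤
      ε * ((Finset.univ.piAntidiag ℓ : Finset (n → ℕ)).card * ℓ !) :=
    sum_prod_factorial_mul_norm_sq_le fun w => hpoly w ▸ hT w
  calc ‖T (r ∘ wordType)‖ ^ 2
      = ‖∑ t ∈ types, r t • v t‖ ^ 2 := by rw [map_comp_wordType]
    _ ≤ (∑ t ∈ types, ‖r t‖ ^ 2 / (∏ j, (t j)! : ℕ)) *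
          ∑ t ∈ types, (∏ j, (t j)! : ℕ) * ‖v t‖ ^ 2 :=
        norm_sum_smul_sq_le types (fun t _ => by positivity) r v
    _ ≤ (∑ x, ‖r (wordType x)‖ ^ 2) / ℓ ! *
          (ε * ((Finset.univ.piAntidiag ℓ : Finset (n → ℕ)).card * ℓ !)) := by
        rw [sum_norm_sq_div_prod_factorial, Fintype.card_fin]
        gcongr
    _ = ε * (Finset.univ.piAntidiag ℓ : Finset (n → ℕ)).card *
          ∑ x, ‖(r ∘ wordType) x‖ ^ 2 := by
        simp only [Function.comp_apply]
        field_simp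
    _ ≤ ε * (ℓ + 1) ^ Fintype.card n * ∑ x, ‖(r ∘ wordType) x‖ ^ 2 := by
        gcongr
        exact_mod_cast card_piAntidiag_univ_le ℓ

end SymmetricTensors

section TensorPower

variable {J : Type*} {ℓ : ℕ}

theorem tensorPower_smul (c : ℂ) (σ : Matrix J J ℂ) (ℓ : ℕ) :
    tensorPower (c • σ) ℓ = c ^ ℓ • tensorPower σ ℓ := by
  ext x y
  simp [tensorPower, Finset.prod_mul_distrib]

variable [Fintype J]

theorem trace_tensorPower (σ : Matrix J J ℂ) (ℓ : ℕ) :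
    (tensorPower σ ℓ).trace = σ.trace ^ ℓ := by
  simp [Matrix.trace, tensorPower, Finset.sum_pow']

theorem conjTranspose_tensorPower_mul_tensorPower (W : Matrix J J ℂ) (ℓ : ℕ) :
    (tensorPower W ℓ).conjTranspose * tensorPower W ℓ = tensorPower (W.conjTranspose * W) ℓ := by
  classical
  ext x y
  simp only [tensorPower, Matrix.mul_apply, Matrix.conjTranspose_apply, Matrix.of_apply,
    star_prod, ← Finset.prod_mul_distrib]
  exact (Fintype.prod_sum fun i j => star (W j (x i)) * W j (y i)).symm

open scoped MatrixOrder in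
theorem exists_eq_conjTranspose_mul_self {P : Matrix J J ℂ} (hP : P.PosSemidef) :
    ∃ W : Matrix J J ℂ, P = W.conjTranspose * W := by
  classical exact CStarAlgebra.nonneg_iff_eq_star_mul_self.1 hP.nonneg

theorem posSemidef_tensorPower {m : Type*} [Finite m] {P : Matrix m m ℂ} (hP : P.PosSemidef)
    (ℓ : ℕ) : (tensorPower P ℓ).PosSemidef := by
  cases nonempty_fintype m
  obtain ⟨W, rfl⟩ := exists_eq_conjTranspose_mul_self hP
  rw [← conjTranspose_tensorPower_mul_tensorPower]
  exact Matrix.posSemidef_conjTranspose_mul_self _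

theorem trace_conjTranspose_mul_self (R : Matrix J J ℂ) :
    (R.conjTranspose * R).trace = ((∑ p : J × J, ‖R p.1 p.2‖ ^ 2 : ℝ) : ℂ) := by
  simp_rw [Fintype.sum_prod_type_right, Complex.ofReal_sum, Matrix.trace, Matrix.diag_apply,
    Matrix.mul_apply, Matrix.conjTranspose_apply, Complex.ofReal_pow, ← Complex.conj_mul']
  rfl

end TensorPower

section States

variable {J : Type*} [Fintype J] [Nonempty J]

variable (J) in
theorem exists_isState : ∃ σ : Matrix J J ℂ, IsState σ := by
  classical
  obtain ⟨j⟩ := ‹Nonempty J›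
  refine ⟨Matrix.vecMulVec (Pi.single j 1) (star (Pi.single j 1)),
    Matrix.posSemidef_vecMulVec_self_star _, ?_⟩
  simp [Matrix.trace_vecMulVec]

theorem exists_isState_eq_trace_smul {P : Matrix J J ℂ} (hP : P.PosSemidef) :
    ∃ σ : Matrix J J ℂ, IsState σ ∧ P = P.trace • σ := by
  classical
  by_cases h : P.trace = 0
  · obtain ⟨σ, hσ⟩ := exists_isState J
    exact ⟨σ, hσ, by rw [h, zero_smul, hP.trace_eq_zero_iff.1 h]⟩
  · refine ⟨P.trace⁻¹ • P, ⟨hP.smul (inv_nonneg.2 hP.trace_nonneg), ?_⟩, ?_⟩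
    · rw [Matrix.trace_smul, smul_eq_mul, inv_mul_cancel₀ h]
    · rw [smul_smul, mul_inv_cancel₀ h, one_smul]

end States

section PositiveFunctional

universe u

/-- An operator on a tensor power is permutation invariant if it commutes with all the operators
`U^π`, that is, if permuting the positions of its row and column indices simultaneously does not
change its entries. -/
def IsPermInvariant {m : Type*} {ℓ : ℕ} (X : Matrix (Fin ℓ → m) (Fin ℓ → m) ℂ) : Prop :=
  ∀ π : Equiv.Perm (Fin ℓ), X.submatrix (· ∘ π) (· ∘ π) = X

variable {J : Type*} {ℓ : ℕ}

theorem submatrix_comp_perm_mul {m : Type*} [Fintype m] (π : Equiv.Perm (Fin ℓ))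
    (X Y : Matrix (Fin ℓ → m) (Fin ℓ → m) ℂ) :
    X.submatrix (· ∘ π) (· ∘ π) * Y.submatrix (· ∘ π) (· ∘ π) =
      (X * Y).submatrix (· ∘ π) (· ∘ π) :=
  Matrix.submatrix_mul_equiv X Y _ (π.symm.arrowCongr (Equiv.refl m)) _

open scoped MatrixOrder in
theorem IsPermInvariant.exists_eq_conjTranspose_mul_self [Fintype J]
    {ζ : Matrix (Fin ℓ → J) (Fin ℓ → J) ℂ} (hζ : ζ.PosSemidef) (hinv : IsPermInvariant ζ) :
    ∃ R : Matrix (Fin ℓ → J) (Fin ℓ → J) ℂ, IsPermInvariant R ∧ ζ = R.conjTranspose * R := by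
  classical
  have hpos : (CFC.sqrt ζ).PosSemidef := Matrix.nonneg_iff_posSemidef.1 (CFC.sqrt_nonneg ζ)
  have hsq : CFC.sqrt ζ * CFC.sqrt ζ = ζ := CFC.sqrt_mul_sqrt_self ζ hζ.nonneg
  refine ⟨CFC.sqrt ζ, fun π => ?_, by rw [hpos.1.eq, hsq]⟩
  have hsq_perm : (CFC.sqrt ζ).submatrix (· ∘ π) (· ∘ π) * (CFC.sqrt ζ).submatrix (· ∘ π) (· ∘ π) =
      ζ := by
    rw [submatrix_comp_perm_mul, hsq, hinv π]
  exact (CFC.sqrt_unique hsq_perm (hpos.submatrix (· ∘ π)).nonneg).symm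

open scoped MatrixOrder Matrix.Norms.L2Operator in
theorem exists_norm_sq_eq_apply_conjTranspose_mul_self {m : Type u} [Fintype m]
    (F : Matrix m m ℂ →ₗ[ℂ] ℂ) (hF : ∀ X : Matrix m m ℂ, X.PosSemidef → 0 ≤ F X) :
    ∃ (E : Type u) (_ : SeminormedAddCommGroup E) (_ : InnerProductSpace ℂ E)
      (T : Matrix m m ℂ →ₗ[ℂ] E), ∀ R, (‖T R‖ ^ 2 : ℂ) = F (R.conjTranspose * R) := by
  classical
  let f : Matrix m m ℂ →ₚ[ℂ] ℂ :=
    .mk₀ F fun X hX => hF X (Matrix.nonneg_iff_posSemidef.1 hX)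
  exact ⟨f.PreGNS, inferInstance, inferInstance, f.toPreGNS, fun R => f.preGNS_norm_sq _⟩

/-- Operators on `J^ℓ` as functions of words over the alphabet `J × J`, whose letters are the pairs
of a row and a column letter. Tensor powers become the functions `x ↦ ∏ i, w (x i)`. -/
def matrixEquivWord (J : Type*) (ℓ : ℕ) :
    Matrix (Fin ℓ → J) (Fin ℓ → J) ℂ ≃ₗ[ℂ] ((Fin ℓ → J × J) → ℂ) where
  toFun X z := X (fun i => (z i).1) fun i => (z i).2
  invFun R := .of fun x y => R fun i => (x i, y i)
  map_add' _ _ := rfl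
  map_smul' _ _ := rfl
  left_inv _ := rfl
  right_inv _ := rfl

variable [Fintype J] {F : Matrix (Fin ℓ → J) (Fin ℓ → J) ℂ →ₗ[ℂ] ℂ} {ε : ℝ}

theorem re_apply_tensorPower_le [Nonempty J]
    (hε : ∀ σ : Matrix J J ℂ, IsState σ → (F (tensorPower σ ℓ)).re ≤ ε)
    {P : Matrix J J ℂ} (hP : P.PosSemidef) :
    (F (tensorPower P ℓ)).re ≤ ε * P.trace.re ^ ℓ := by
  obtain ⟨σ, hσ, hPσ⟩ := exists_isState_eq_trace_smul hP
  have htrace : P.trace = (P.trace.re : ℂ) := Complex.eq_re_of_ofReal_le hP.trace_nonneg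
  calc (F (tensorPower P ℓ)).re = P.trace.re ^ ℓ * (F (tensorPower σ ℓ)).re := by
        rw [hPσ, tensorPower_smul, map_smul, smul_eq_mul, htrace, ← Complex.ofReal_pow,
          Complex.re_ofReal_mul]
        simp [hσ.2]
    _ ≤ P.trace.re ^ ℓ * ε :=
        mul_le_mul_of_nonneg_left (hε σ hσ) (pow_nonneg (Complex.nonneg_iff.1 hP.trace_nonneg).1 ℓ)
    _ = ε * P.trace.re ^ ℓ := mul_comm _ _

theorem re_apply_le_of_isPermInvariant [Nonempty J] (hF : ∀ X, X.PosSemidef → 0 ≤ F X)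
    (hε : ∀ σ : Matrix J J ℂ, IsState σ → (F (tensorPower σ ℓ)).re ≤ ε)
    {ζ : Matrix (Fin ℓ → J) (Fin ℓ → J) ℂ} (hζ : ζ.PosSemidef) (hinv : IsPermInvariant ζ) :
    (F ζ).re ≤ ε * (ℓ + 1) ^ Fintype.card J ^ 2 * ζ.trace.re := by
  obtain ⟨E, _, _, T, hT⟩ := exists_norm_sq_eq_apply_conjTranspose_mul_self F hF
  obtain ⟨R, hR, rfl⟩ := IsPermInvariant.exists_eq_conjTranspose_mul_self hζ hinv
  have hε_nonneg : 0 ≤ ε := by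
    obtain ⟨σ, hσ⟩ := exists_isState J
    exact (Complex.nonneg_iff.1 (hF _ (posSemidef_tensorPower hσ.1 ℓ))).1.trans (hε σ hσ)
  have hT_re (R) : ‖T R‖ ^ 2 = (F (R.conjTranspose * R)).re := by
    rw [← hT, ← Complex.ofReal_pow, Complex.ofReal_re]
  have hproduct (w : J × J → ℂ) :
      ‖T ((matrixEquivWord J ℓ).symm fun z => ∏ i, w (z i))‖ ^ 2 ≤
        ε * (∑ p, ‖w p‖ ^ 2) ^ ℓ := by
    let W : Matrix J J ℂ := .of fun a b => w (a, b)
    have hW : (matrixEquivWord J ℓ).symm (fun z => ∏ i, w (z i)) = tensorPower W ℓ := rfl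
    have htrace : ∑ p, ‖w p‖ ^ 2 = (W.conjTranspose * W).trace.re := by
      rw [trace_conjTranspose_mul_self, Complex.ofReal_re]
      rfl
    rw [hW, hT_re, conjTranspose_tensorPower_mul_tensorPower, htrace]
    exact re_apply_tensorPower_le hε (Matrix.posSemidef_conjTranspose_mul_self W)
  have hsymm (π : Equiv.Perm (Fin ℓ)) (z : Fin ℓ → J × J) :
      matrixEquivWord J ℓ R (z ∘ π) = matrixEquivWord J ℓ R z :=
    congrFun (congrArg (matrixEquivWord J ℓ) (hR π)) z
  have hbound := norm_sq_le_of_symmetric (T ∘ₗ (matrixEquivWord J ℓ).symm.toLinearMap) hε_nonneg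
    hproduct hsymm
  have htrace : ∑ z, ‖matrixEquivWord J ℓ R z‖ ^ 2 = (R.conjTranspose * R).trace.re := by
    rw [trace_conjTranspose_mul_self, Complex.ofReal_re]
    exact Fintype.sum_equiv (Equiv.arrowProdEquivProdArrow _ _ _) _ _ fun _ => rfl
  rw [htrace, Fintype.card_prod, ← sq] at hbound
  exact (hT_re R).symm.trans_le hbound

end PositiveFunctional

section CompletePositivity

variable {m n : Type*}

theorem posSemidef_of_sum_entries {r : Type*} [Finite r] [Fintype m]
    {M : Matrix (r × m) (r × m) ℂ} (hM : M.PosSemidef) :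
    (Matrix.of fun a b => ∑ x, ∑ x', M (a, x) (b, x')).PosSemidef := by
  classical
  cases nonempty_fintype r
  let V : Matrix r (r × m) ℂ := .of fun a p => if a = p.1 then 1 else 0
  have hV : (Matrix.of fun a b => ∑ x, ∑ x', M (a, x) (b, x')) = V * M * V.conjTranspose := by
    ext a b
    rw [Matrix.of_apply, Finset.sum_comm]
    simp [V, Matrix.mul_apply, Fintype.sum_prod_type_right, apply_ite star]
  rw [hV]
  exact hM.mul_mul_conjTranspose_same V

theorem trace_ampliation {k : Type*} [Fintype k] [Fintype m] [Fintype n]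
    {Φ : Matrix m m ℂ →ₗ[ℂ] Matrix n n ℂ} {c : ℂ} (hΦ : ∀ X, (Φ X).trace = c * X.trace)
    (X : Matrix (k × m) (k × m) ℂ) :
    (ampliation k Φ X).trace = c * X.trace := by
  simp only [Matrix.trace, Matrix.diag_apply, Fintype.sum_prod_type, Finset.mul_sum] at hΦ ⊢
  exact Finset.sum_congr rfl fun p _ => hΦ (.of fun x y => X (p, x) (p, y))

variable [DecidableEq m]

/-- The Choi matrix of a linear map on operators, whose positivity characterizes the completely
positive maps. -/
def choi (Φ : Matrix m m ℂ →ₗ[ℂ] Matrix n n ℂ) : Matrix (m × n) (m × n) ℂ :=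
  .of fun p q => Φ (Matrix.single p.1 q.1 1) p.2 q.2

theorem map_apply_eq_sum_choi [Fintype m] (Φ : Matrix m m ℂ →ₗ[ℂ] Matrix n n ℂ)
    (X : Matrix m m ℂ) (y y' : n) :
    Φ X y y' = ∑ x, ∑ x', X x x' * choi Φ (x, y) (x', y') := by
  conv_lhs => rw [Matrix.matrix_eq_sum_single X]
  simp_rw [map_sum, Matrix.sum_apply, choi, Matrix.of_apply]
  refine Finset.sum_congr rfl fun x _ => Finset.sum_congr rfl fun x' _ => ?_
  rw [← mul_one (X x x'), ← smul_eq_mul, ← Matrix.smul_single, map_smul]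
  simp

theorem IsCompletelyPositive.posSemidef_choi [Finite m]
    {Φ : Matrix m m ℂ →ₗ[ℂ] Matrix n n ℂ} (hΦ : IsCompletelyPositive Φ) : (choi Φ).PosSemidef := by
  let e := Finite.equivFin m
  let v : Fin (Nat.card m) × m → ℂ := fun p => if p.1 = e p.2 then 1 else 0
  have hblock (p q : m × n) : (Matrix.of fun x x' => Matrix.vecMulVec v (star v) (e p.1, x)
      (e q.1, x')) = Matrix.single p.1 q.1 1 := by
    ext x x'
    simp [v, Matrix.vecMulVec_apply, Matrix.single_apply, apply_ite star, ← ite_and, and_comm]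
  have hchoi : choi Φ =
      (ampliation (Fin (Nat.card m)) Φ (Matrix.vecMulVec v (star v))).submatrix
        (Prod.map e id) (Prod.map e id) := by
    ext p q
    exact congrArg (fun X => Φ X p.2 q.2) (hblock p q).symm
  rw [hchoi]
  exact (hΦ _ _ (Matrix.posSemidef_vecMulVec_self_star v)).submatrix _

theorem isCompletelyPositive_of_posSemidef_choi [Finite m] [Finite n]
    {Φ : Matrix m m ℂ →ₗ[ℂ] Matrix n n ℂ} (hΦ : (choi Φ).PosSemidef) :
    IsCompletelyPositive Φ := by
  cases nonempty_fintype m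
  intro k X hX
  have hampliation : ampliation (Fin k) Φ X = .of fun p q => ∑ x, ∑ x',
      (X ⊗ₖ choi Φ).submatrix (fun z : (Fin k × n) × m => ((z.1.1, z.2), (z.2, z.1.2)))
        (fun z => ((z.1.1, z.2), (z.2, z.1.2))) (p, x) (q, x') := by
    ext p q
    exact map_apply_eq_sum_choi Φ _ p.2 q.2
  rw [hampliation]
  exact posSemidef_of_sum_entries ((hX.kronecker hΦ).submatrix _)

variable [Fintype m]

theorem choi_tensorPowerMap (Φ : Matrix m m ℂ →ₗ[ℂ] Matrix n n ℂ) (ℓ : ℕ) :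
    choi (tensorPowerMap Φ ℓ) = (tensorPower (choi Φ) ℓ).submatrix
      (Equiv.arrowProdEquivProdArrow (Fin ℓ) (fun _ => m) fun _ => n).symm
      (Equiv.arrowProdEquivProdArrow (Fin ℓ) (fun _ => m) fun _ => n).symm := by
  ext p q
  simp [choi, tensorPowerMap, tensorPower, Equiv.arrowProdEquivProdArrow, Matrix.single_apply,
    ite_and]

theorem IsCompletelyPositive.tensorPowerMap [Finite n] {Φ : Matrix m m ℂ →ₗ[ℂ] Matrix n n ℂ}
    (hΦ : IsCompletelyPositive Φ) (ℓ : ℕ) : IsCompletelyPositive (tensorPowerMap Φ ℓ) := by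
  classical
  apply isCompletelyPositive_of_posSemidef_choi
  rw [choi_tensorPowerMap]
  exact (posSemidef_tensorPower hΦ.posSemidef_choi ℓ).submatrix _

variable [Fintype n]

theorem IsTracePreserving.sum_choi {Φ : Matrix m m ℂ →ₗ[ℂ] Matrix n n ℂ}
    (hΦ : IsTracePreserving Φ) (x x' : m) :
    ∑ y, choi Φ (x, y) (x', y) = (1 : Matrix m m ℂ) x x' := by
  rw [Matrix.one_apply]
  refine (hΦ (Matrix.single x x' 1)).trans ?_
  split_ifs with h
  · rw [h, Matrix.trace_single_eq_same]
  · exact Matrix.trace_single_eq_of_ne _ _ _ h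

theorem isTracePreserving_of_sum_choi {Φ : Matrix m m ℂ →ₗ[ℂ] Matrix n n ℂ}
    (hΦ : ∀ x x', ∑ y, choi Φ (x, y) (x', y) = (1 : Matrix m m ℂ) x x') :
    IsTracePreserving Φ := by
  intro X
  simp_rw [Matrix.trace, Matrix.diag_apply, map_apply_eq_sum_choi Φ X]
  rw [Finset.sum_comm]
  simp_rw [Finset.sum_comm (s := (Finset.univ : Finset n)), ← Finset.mul_sum, hΦ]
  simp [Matrix.one_apply]

theorem IsTracePreserving.tensorPowerMap {Φ : Matrix m m ℂ →ₗ[ℂ] Matrix n n ℂ}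
    (hΦ : IsTracePreserving Φ) (ℓ : ℕ) : IsTracePreserving (tensorPowerMap Φ ℓ) := by
  classical
  refine isTracePreserving_of_sum_choi fun x x' => ?_
  calc ∑ y, choi (QAVC.tensorPowerMap Φ ℓ) (x, y) (x', y)
      = ∑ y : Fin ℓ → n, ∏ i, choi Φ (x i, y i) (x' i, y i) := by
        rw [choi_tensorPowerMap]
        rfl
    _ = ∏ i, (1 : Matrix m m ℂ) (x i) (x' i) := by
        rw [← Fintype.prod_sum fun i y => choi Φ (x i, y) (x' i, y)]
        simp_rw [hΦ.sum_choi]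
    _ = (1 : Matrix (Fin ℓ → m) (Fin ℓ → m) ℂ) x x' := by
        simp [Matrix.one_apply, Finset.prod_ite_zero, funext_iff]

end CompletePositivity

section Jammer

variable {A J B : Type*}

theorem fixJammer_add (M : Matrix (A × J) (A × J) ℂ →ₗ[ℂ] Matrix B B ℂ) (σ σ' : Matrix J J ℂ) :
    fixJammer M (σ + σ') = fixJammer M σ + fixJammer M σ' := by
  ext1 ρ
  simp [fixJammer, Matrix.kronecker_add]

theorem fixJammer_smul (M : Matrix (A × J) (A × J) ℂ →ₗ[ℂ] Matrix B B ℂ) (c : ℂ)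
    (σ : Matrix J J ℂ) : fixJammer M (c • σ) = c • fixJammer M σ := by
  ext1 ρ
  simp [fixJammer, Matrix.kronecker_smul]

theorem IsCompletelyPositive.fixJammer [Finite A] [Finite J]
    {M : Matrix (A × J) (A × J) ℂ →ₗ[ℂ] Matrix B B ℂ} (hM : IsCompletelyPositive M)
    {σ : Matrix J J ℂ} (hσ : σ.PosSemidef) :
    IsCompletelyPositive (fixJammer M σ) := fun k _ hX =>
  hM k _ ((hX.kronecker hσ).submatrix (Equiv.prodAssoc (Fin k) A J).symm)

theorem IsTracePreserving.trace_fixJammer [Fintype A] [Fintype J] [Fintype B]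
    {M : Matrix (A × J) (A × J) ℂ →ₗ[ℂ] Matrix B B ℂ} (hM : IsTracePreserving M)
    (σ : Matrix J J ℂ) (ρ : Matrix A A ℂ) :
    (QAVC.fixJammer M σ ρ).trace = σ.trace * ρ.trace := by
  rw [mul_comm, ← Matrix.trace_kronecker]
  exact hM _

variable [Fintype A] [DecidableEq A] [Fintype J] [DecidableEq J]

theorem IsCompletelyPositive.blockMap [Finite B]
    {N : Matrix (A × J) (A × J) ℂ →ₗ[ℂ] Matrix B B ℂ} (hN : IsCompletelyPositive N) (ℓ : ℕ) :
    IsCompletelyPositive (blockMap N ℓ) := by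
  intro k X hX
  let e := Equiv.arrowProdEquivProdArrow (Fin ℓ) (fun _ => A) fun _ => J
  have hampliation : ampliation (Fin k) (QAVC.blockMap N ℓ) X = ampliation (Fin k)
      (QAVC.tensorPowerMap N ℓ) (X.submatrix (Prod.map id e) (Prod.map id e)) := by
    ext p q
    rfl
  rw [hampliation]
  exact hN.tensorPowerMap ℓ k _ (hX.submatrix _)

theorem IsTracePreserving.blockMap [Fintype B]
    {N : Matrix (A × J) (A × J) ℂ →ₗ[ℂ] Matrix B B ℂ} (hN : IsTracePreserving N) (ℓ : ℕ) :
    IsTracePreserving (blockMap N ℓ) := fun X =>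
  (hN.tensorPowerMap ℓ _).trans
    (Equiv.sum_comp (Equiv.arrowProdEquivProdArrow (Fin ℓ) (fun _ => A) fun _ => J) fun z => X z z)

end Jammer

section Fidelity

theorem maxEntangled_eq_vecMulVec (L : ℕ) :
    maxEntangled L = (L : ℂ)⁻¹ • Matrix.vecMulVec
      (fun p : Fin L × Fin L => if p.1 = p.2 then (1 : ℂ) else 0)
      (star fun p : Fin L × Fin L => if p.1 = p.2 then (1 : ℂ) else 0) := by
  ext p q
  simp [maxEntangled, Matrix.vecMulVec_apply, apply_ite star, ← ite_and, and_comm]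

theorem posSemidef_maxEntangled (L : ℕ) : (maxEntangled L).PosSemidef := by
  rw [maxEntangled_eq_vecMulVec]
  exact (Matrix.posSemidef_vecMulVec_self_star _).smul (inv_nonneg.2 L.cast_nonneg)

theorem trace_maxEntangled {L : ℕ} (hL : L ≠ 0) : (maxEntangled L).trace = 1 := by
  simp [Matrix.trace, maxEntangled, Fintype.sum_prod_type, hL]

theorem isIdempotentElem_maxEntangled (L : ℕ) : IsIdempotentElem (maxEntangled L) := by
  ext p q
  have hL : (L : ℂ) ≠ 0 := Nat.cast_ne_zero.2 (Fin.pos p.1).ne'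
  by_cases hp : p.1 = p.2 <;> by_cases hq : q.1 = q.2 <;>
    simp [maxEntangled, Matrix.mul_apply, Fintype.sum_prod_type, hp, hq, hL]

theorem posSemidef_one_sub_maxEntangled (L : ℕ) : (1 - maxEntangled L).PosSemidef := by
  have hHerm : (1 - maxEntangled L).conjTranspose = 1 - maxEntangled L := by
    rw [Matrix.conjTranspose_sub, Matrix.conjTranspose_one, (posSemidef_maxEntangled L).1.eq]
  have hsq := (isIdempotentElem_maxEntangled L).one_sub.eq
  rw [← hsq]
  nth_rw 1 [← hHerm]
  exact Matrix.posSemidef_conjTranspose_mul_self _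

theorem trace_mul_nonneg {m : Type*} [Fintype m] {X Y : Matrix m m ℂ} (hX : X.PosSemidef)
    (hY : Y.PosSemidef) : 0 ≤ (X * Y).trace := by
  obtain ⟨S, rfl⟩ := exists_eq_conjTranspose_mul_self hY
  rw [← mul_assoc, Matrix.trace_mul_comm, ← mul_assoc]
  exact (hX.mul_mul_conjTranspose_same S).trace_nonneg

/-- The entanglement fidelity `tr ((id ⊗ Φ) Φ_L) Φ_L` of a map `Φ` on operators on `ℂ^L`, as a
linear functional of `Φ`. -/
noncomputable def entanglementFidelity (L : ℕ) :
    (Matrix (Fin L) (Fin L) ℂ →ₗ[ℂ] Matrix (Fin L) (Fin L) ℂ) →ₗ[ℂ] ℂ where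
  toFun Φ := (ampliation (Fin L) Φ (maxEntangled L) * maxEntangled L).trace
  map_add' Φ Ψ := by
    rw [← Matrix.trace_add, ← add_mul]
    rfl
  map_smul' c Φ := by
    rw [RingHom.id_apply, ← Matrix.trace_smul, ← Matrix.smul_mul]
    rfl

theorem entanglementFidelity_le {L : ℕ}
    {Φ : Matrix (Fin L) (Fin L) ℂ →ₗ[ℂ] Matrix (Fin L) (Fin L) ℂ}
    (hΦ : IsCompletelyPositive Φ) {c : ℂ} (hc : 0 ≤ c) (htrace : ∀ X, (Φ X).trace = c * X.trace) :
    entanglementFidelity L Φ ≤ c := by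
  rcases eq_or_ne L 0 with rfl | hL
  · exact hc.trans_eq' (by simp [entanglementFidelity, Matrix.trace])
  have hpos := trace_mul_nonneg (hΦ L _ (posSemidef_maxEntangled L))
    (posSemidef_one_sub_maxEntangled L)
  rwa [mul_sub, mul_one, Matrix.trace_sub, trace_ampliation htrace, trace_maxEntangled hL, mul_one,
    sub_nonneg] at hpos

end Fidelity

section ErrorFunctional

variable {A J B : Type*} [Fintype A] [DecidableEq A] [Fintype J] [DecidableEq J] [Fintype B]
  (N : Channel (A × J) B) {ℓ L : ℕ} (Q : QuantumCode A B ℓ L)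

/-- The infidelity of a code, made linear in the jammer's operator `ζ` by replacing the constant
`1` by the trace of `ζ`. -/
noncomputable def errorFunctional : Matrix (Fin ℓ → J) (Fin ℓ → J) ℂ →ₗ[ℂ] ℂ where
  toFun ζ := ζ.trace -
    entanglementFidelity L (Q.dec.map ∘ₗ fixJammer (blockMap N.map ℓ) ζ ∘ₗ Q.enc.map)
  map_add' ζ ζ' := by
    rw [fixJammer_add, LinearMap.add_comp, LinearMap.comp_add, map_add, Matrix.trace_add]
    ring
  map_smul' c ζ := by
    rw [fixJammer_smul, LinearMap.smul_comp, LinearMap.comp_smul, map_smul, Matrix.trace_smul,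
      ← smul_sub, RingHom.id_apply]

theorem infidelity_eq_re_errorFunctional {ζ : Matrix (Fin ℓ → J) (Fin ℓ → J) ℂ}
    (hζ : ζ.trace = 1) : infidelity N Q ζ = (errorFunctional N Q ζ).re := by
  simp [infidelity, errorFunctional, entanglementFidelity, hζ]

theorem errorFunctional_nonneg {ζ : Matrix (Fin ℓ → J) (Fin ℓ → J) ℂ} (hζ : ζ.PosSemidef) :
    0 ≤ errorFunctional N Q ζ := by
  have hjammer := (N.completelyPositive.blockMap ℓ).fixJammer hζ
  refine sub_nonneg.2 (entanglementFidelity_le (fun k X hX => Q.dec.completelyPositive k _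
    (hjammer k _ (Q.enc.completelyPositive k X hX))) hζ.trace_nonneg fun X => ?_)
  calc (Q.dec.map (fixJammer (blockMap N.map ℓ) ζ (Q.enc.map X))).trace
      = (fixJammer (blockMap N.map ℓ) ζ (Q.enc.map X)).trace := Q.dec.tracePreserving _
    _ = ζ.trace * (Q.enc.map X).trace := (N.tracePreserving.blockMap ℓ).trace_fixJammer ζ _
    _ = ζ.trace * X.trace := by rw [Q.enc.tracePreserving]

end ErrorFunctional

section Twirl

variable {m : Type*} {ℓ : ℕ}

/-- The permutation twirl: the average of an operator over simultaneous permutations of its row and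
column indices. -/
noncomputable def permTwirl (X : Matrix (Fin ℓ → m) (Fin ℓ → m) ℂ) :
    Matrix (Fin ℓ → m) (Fin ℓ → m) ℂ :=
  ((ℓ.factorial : ℝ)⁻¹ : ℂ) • ∑ π : Equiv.Perm (Fin ℓ), X.submatrix (· ∘ π) (· ∘ π)

theorem isPermInvariant_permTwirl (X : Matrix (Fin ℓ → m) (Fin ℓ → m) ℂ) :
    IsPermInvariant (permTwirl X) := by
  intro π
  ext x y
  simp only [permTwirl, Matrix.submatrix_apply, Matrix.smul_apply, Matrix.sum_apply]
  congr 1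
  exact Equiv.sum_comp (Equiv.mulLeft π) fun τ : Equiv.Perm (Fin ℓ) => X (x ∘ τ) (y ∘ τ)

variable [Fintype m]

theorem trace_submatrix_comp_perm (π : Equiv.Perm (Fin ℓ)) (X : Matrix (Fin ℓ → m) (Fin ℓ → m) ℂ) :
    (X.submatrix (· ∘ π) (· ∘ π)).trace = X.trace :=
  Equiv.sum_comp (π.symm.arrowCongr (Equiv.refl m)) fun x => X x x

theorem IsState.permTwirl {ζ : Matrix (Fin ℓ → m) (Fin ℓ → m) ℂ} (hζ : IsState ζ) :
    IsState (permTwirl ζ) := by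
  constructor
  · refine (Matrix.posSemidef_sum _ fun π _ => hζ.1.submatrix _).smul ?_
    rw [← Complex.ofReal_inv]
    exact Complex.zero_le_real.2 (by positivity)
  · simp_rw [QAVC.permTwirl, Matrix.trace_smul, Matrix.trace_sum, trace_submatrix_comp_perm, hζ.2]
    simp [Fintype.card_perm, ℓ.factorial_ne_zero]

theorem conjMap_permOp [DecidableEq m] (π : Equiv.Perm (Fin ℓ))
    (X : Matrix (Fin ℓ → m) (Fin ℓ → m) ℂ) :
    conjMap (permOp m π) X = X.submatrix (· ∘ π) (· ∘ π) := by
  ext y y'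
  have hcomp (x y : Fin ℓ → m) : y = x ∘ π.symm ↔ x = y ∘ π := by
    rw [Equiv.eq_comp_symm, eq_comm]
  simp [conjMap, permOp, Matrix.mul_apply, hcomp, apply_ite star]

variable [DecidableEq m]

theorem tensorPowerMap_submatrix_comp_perm {n : Type*} (Φ : Matrix m m ℂ →ₗ[ℂ] Matrix n n ℂ)
    (π : Equiv.Perm (Fin ℓ)) (X : Matrix (Fin ℓ → m) (Fin ℓ → m) ℂ) :
    tensorPowerMap Φ ℓ (X.submatrix (· ∘ π) (· ∘ π)) =
      (tensorPowerMap Φ ℓ X).submatrix (· ∘ π) (· ∘ π) := by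
  ext y y'
  let e : (Fin ℓ → m) ≃ (Fin ℓ → m) := π.symm.arrowCongr (Equiv.refl m)
  refine Fintype.sum_equiv e _ _ fun x => Fintype.sum_equiv e _ _ fun x' => ?_
  congr 1
  exact (Equiv.prod_comp π fun i => Φ (Matrix.single (x i) (x' i) 1) (y i) (y' i)).symm

end Twirl

section Code

variable {A J B : Type*} [Fintype A] [DecidableEq A] [Fintype J] [DecidableEq J]

theorem fixJammer_blockMap_submatrix_comp_perm (N : Matrix (A × J) (A × J) ℂ →ₗ[ℂ] Matrix B B ℂ)
    {ℓ : ℕ} (π : Equiv.Perm (Fin ℓ)) (ζ : Matrix (Fin ℓ → J) (Fin ℓ → J) ℂ)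
    (ρ : Matrix (Fin ℓ → A) (Fin ℓ → A) ℂ) :
    fixJammer (blockMap N ℓ) (ζ.submatrix (· ∘ π) (· ∘ π)) (ρ.submatrix (· ∘ π) (· ∘ π)) =
      (fixJammer (blockMap N ℓ) ζ ρ).submatrix (· ∘ π) (· ∘ π) := by
  let e := Equiv.arrowProdEquivProdArrow (Fin ℓ) (fun _ => A) fun _ => J
  exact tensorPowerMap_submatrix_comp_perm N π ((ρ ⊗ₖ ζ).submatrix e e)

variable [Fintype B] [DecidableEq B] (N : Channel (A × J) B) {ℓ L : ℕ} (Q : QuantumCode A B ℓ L)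

theorem infidelity_permute (π : Equiv.Perm (Fin ℓ)) (ζ : Matrix (Fin ℓ → J) (Fin ℓ → J) ℂ) :
    infidelity N (Q.permute π) ζ = infidelity N Q (ζ.submatrix (· ∘ ⇑π⁻¹) (· ∘ ⇑π⁻¹)) := by
  have hmap : (Q.permute π).dec.map ∘ₗ fixJammer (blockMap N.map ℓ) ζ ∘ₗ (Q.permute π).enc.map =
      Q.dec.map ∘ₗ fixJammer (blockMap N.map ℓ) (ζ.submatrix (· ∘ ⇑π⁻¹) (· ∘ ⇑π⁻¹)) ∘ₗ
        Q.enc.map := by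
    ext1 X
    change Q.dec.map (conjMap (permOp B π⁻¹) (fixJammer (blockMap N.map ℓ) ζ
      (conjMap (permOp A π) (Q.enc.map X)))) = Q.dec.map _
    rw [conjMap_permOp, conjMap_permOp, ← fixJammer_blockMap_submatrix_comp_perm]
    simp only [Matrix.submatrix_submatrix, Function.comp_def, Equiv.Perm.inv_def,
      Equiv.symm_apply_apply]
    rfl
  rw [infidelity, infidelity, hmap]

theorem randomInfidelity_permute {ζ : Matrix (Fin ℓ → J) (Fin ℓ → J) ℂ} (hζ : ζ.trace = 1) :
    randomInfidelity N (fun π : Equiv.Perm (Fin ℓ) => Q.permute π) ζ =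
      (errorFunctional N Q (permTwirl ζ)).re := by
  have hπ (π : Equiv.Perm (Fin ℓ)) : infidelity N (Q.permute π) ζ =
      (errorFunctional N Q (ζ.submatrix (· ∘ ⇑π⁻¹) (· ∘ ⇑π⁻¹))).re := by
    rw [infidelity_permute, infidelity_eq_re_errorFunctional N Q
      ((trace_submatrix_comp_perm π⁻¹ ζ).trans hζ)]
  rw [randomInfidelity, permTwirl, map_smul, map_sum, smul_eq_mul, ← Complex.ofReal_inv,
    Complex.re_ofReal_mul, Complex.re_sum, Fintype.card_perm, Fintype.card_fin, div_eq_inv_mul,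
    ← Equiv.sum_comp (Equiv.inv (Equiv.Perm (Fin ℓ)))]
  simp_rw [hπ]
  rfl

end Code

end QAVC

theorem proposition1 {A J B : Type*} [Fintype A] [DecidableEq A] [Fintype J] [DecidableEq J]
    [Nonempty J] [Fintype B] [DecidableEq B] (N : QAVC.Channel (A × J) B) {ℓ L : ℕ}
    (Q : QAVC.QuantumCode A B ℓ L) (ε : ℝ)
    (hQ : ∀ σ : Matrix J J ℂ, QAVC.IsState σ →
      QAVC.infidelity N Q (QAVC.tensorPower σ ℓ) ≤ ε) :
    ∀ ζ : Matrix (Fin ℓ → J) (Fin ℓ → J) ℂ, QAVC.IsState ζ →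
      QAVC.randomInfidelity N (fun π : Equiv.Perm (Fin ℓ) => Q.permute π) ζ ≤
        ε * ((ℓ : ℝ) + 1) ^ (Fintype.card J ^ 2) := by
  intro ζ hζ
  have hproduct (σ : Matrix J J ℂ) (hσ : QAVC.IsState σ) :
      (QAVC.errorFunctional N Q (QAVC.tensorPower σ ℓ)).re ≤ ε := by
    have htrace : (QAVC.tensorPower σ ℓ).trace = 1 := by
      rw [QAVC.trace_tensorPower, hσ.2, one_pow]
    exact (QAVC.infidelity_eq_re_errorFunctional N Q htrace).symm.trans_le (hQ σ hσ)
  have hbound := QAVC.re_apply_le_of_isPermInvariant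
    (fun X hX => QAVC.errorFunctional_nonneg N Q hX) hproduct hζ.permTwirl.1
    (QAVC.isPermInvariant_permTwirl ζ)
  rwa [hζ.permTwirl.2, Complex.one_re, mul_one, ← QAVC.randomInfidelity_permute N Q hζ.2] at hbound
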